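/- Define the local Zygmund classes on the real line as follows. $\mathcal{Z}^{0,1}(\mathbb{R})$ is the set of all continuous functions $g:\mathbb{R}\to\mathbb{R}$ such that for every compact set $K\subseteq\mathbb{R}$ $$\sup\Big\{\frac{|g(x+h)-2g(x)+g(x-h)|}{|h|} : x,\ x+h,\ x-h\in K,\ h\neq 0\Big\}<\infty .$$ For an integer $m\ge 1$, $\mathcal{Z}^{m,1}(\mathbb{R})$ is the set of all $g\in\mathcal{C}^m(\mathbb{R})$ with $g^{(m)}\in\mathcal{Z}^{0,1}(\mathbb{R})$. Let $m\ge 1$ be an integer and let $f:\mathbb{R}^2\to\mathbb{R}$ be a function such that $f\circ c\in\mathcal{Z}^{m,1}(\mathbb{R})$ for every $\mathcal{C}^\infty$-curve $c:\mathbb{R}\to\mathbb{R}^2$. Then the partial derivative $\partial_2 f(x,0)$ of $f$ in the second variable exists for every $x\in\mathbb{R}$, and the function $x\mapsto\partial_2 f(x,0)$ belongs to $\mathcal{Z}^{m-1,1}(\mathbb{R})$. -/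

import Mathlib

open scoped ContDiff

/-- The local Zygmund class of order zero on the real line: continuous functions whose symmetric
second difference quotients `|g (x + h) - 2 g x + g (x - h)| / |h|` are bounded for
`x, x + h, x - h ∈ K`, `h ≠ 0`, for every compact set `K`. -/
def IsZygmundZero (g : ℝ → ℝ) : Prop :=
  Continuous g ∧
    ∀ K : Set ℝ, IsCompact K → ∃ C : ℝ, ∀ x h : ℝ,
      x ∈ K → x + h ∈ K → x - h ∈ K → h ≠ 0 →
        |g (x + h) - 2 * g x + g (x - h)| / |h| ≤ C

/-- The local Zygmund class of order `m` on the real line: functions of class `C^m`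
whose `m`-th derivative lies in the Zygmund class of order zero. -/
def IsZygmund (m : ℕ) (g : ℝ → ℝ) : Prop :=
  ContDiff ℝ m g ∧ IsZygmundZero (iteratedDeriv m g)

/-!
The argument replaces derivatives by iterated forward differences. On the real line, `g` lies in the
local Zygmund class of order `p` exactly when it is locally bounded and, for some (equivalently
every) order `N ≥ p + 2`, its differences of order `N` with step `h` are locally `O(h ^ (p + 1))`:
see `IsZygmund.locallyDiffBounded` (for `N = p + 2`) and `LocallyDiffBounded.isZygmund`.

Hence it suffices to bound the differences of order `N = m + 2` of `g x = ∂₂ f (x, 0)` by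
`O(h ^ m)`. The difference of order `N` of `g` at `x` with step `h` is the derivative at `0` of
`F y = Δ_{(h, 0)}^N f (x, y)`. Suppose that the differences of order `N` of `f` in both coordinate
directions are `O(h ^ (m + 1))`, uniformly on bounded sets. Then `F` is `O(h ^ (m + 1))`, and its
own differences of order `N` with step `t` are `O(t ^ (m + 1))`, so the interpolation inequality
`exists_abs_deriv_le`, used at scale `h`, gives `F' 0 = O(h ^ m)`. The interpolation inequality, as
well as the converse part of the difference characterization, rests on Marchaud's inequality
`marchaud`, which lowers the order of a difference as long as the bound decays slower than the
corresponding power of the step.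

The uniform bounds on the differences of `f` come from the hypothesis on smooth curves
(`exists_abs_fwdDiff_le_closedBall_of_isZygmund_comp`): if they failed near a point, there would be
violating progressions converging arbitrarily fast to it, and by
`exists_contDiff_curve_affine_pieces` a single smooth curve runs through all of them, with affine
parametrizations whose speeds tend to zero. Along this curve `f` would not be Zygmund.
-/

open Filter Topology

/-! ### Iterated forward differences -/

lemma fwdDiff_iter_succ_eval {M : Type*} [AddCommMonoid M] (F : M → ℝ) (h : M) (n : ℕ) (x : M) :
    (fwdDiff h)^[n + 1] F x = (fwdDiff h)^[n] F (x + h) - (fwdDiff h)^[n] F x := by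
  rw [Function.iterate_succ_apply']
  rfl

lemma abs_fwdDiff_iter_le {M : Type*} [AddCommMonoid M] {F : M → ℝ} {h : M} {A : ℝ} {n : ℕ}
    {x : M} (hF : ∀ k ≤ n, |F (x + k • h)| ≤ A) : |(fwdDiff h)^[n] F x| ≤ 2 ^ n * A := by
  induction n generalizing x with
  | zero => simpa using hF 0 le_rfl
  | succ n ih =>
    have h1 : |(fwdDiff h)^[n] F x| ≤ 2 ^ n * A := ih fun k hk => hF k (by omega)
    have h2 : |(fwdDiff h)^[n] F (x + h)| ≤ 2 ^ n * A := ih fun k hk => by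
      have := hF (k + 1) (by omega)
      rwa [succ_nsmul', ← add_assoc] at this
    rw [fwdDiff_iter_succ_eval, pow_succ]
    linarith [abs_sub ((fwdDiff h)^[n] F (x + h)) ((fwdDiff h)^[n] F x)]

lemma fwdDiff_iter_comm {M : Type*} [AddCommMonoid M] (F : M → ℝ) (h k : M) (m n : ℕ) :
    (fwdDiff h)^[m] ((fwdDiff k)^[n] F) = (fwdDiff k)^[n] ((fwdDiff h)^[m] F) := by
  have hc : Function.Commute (fwdDiff h : (M → ℝ) → M → ℝ) (fwdDiff k) := fun G => by
    ext x
    simp only [fwdDiff, add_right_comm x h k]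
    ring
  exact (hc.iterate_iterate m n).eq F

/-- Iterated differences only depend on the values along the progression `x, x + h, …`. -/
lemma fwdDiff_iter_congr {M M' : Type*} [AddCommMonoid M] [AddCommMonoid M'] {F : M → ℝ}
    {G : M' → ℝ} {h x : M} {h' x' : M'} {n : ℕ}
    (hFG : ∀ k ≤ n, F (x + k • h) = G (x' + k • h')) :
    (fwdDiff h)^[n] F x = (fwdDiff h')^[n] G x' := by
  rw [fwdDiff_iter_eq_sum_shift, fwdDiff_iter_eq_sum_shift]
  refine Finset.sum_congr rfl fun k hk => ?_
  rw [hFG k (Nat.lt_succ_iff.1 (Finset.mem_range.1 hk))]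

/-- The difference operator acts on the second argument, so it commutes with differentiation
in the first one. -/
lemma hasDerivAt_fwdDiff_iter {M : Type*} [AddCommMonoid M] {F : ℝ → M → ℝ} {F' : M → ℝ}
    {y₀ : ℝ} (hF : ∀ x, HasDerivAt (fun y => F y x) (F' x) y₀) (h : M) (n : ℕ) (x : M) :
    HasDerivAt (fun y => (fwdDiff h)^[n] (F y) x) ((fwdDiff h)^[n] F' x) y₀ := by
  induction n generalizing x with
  | zero => exact hF x
  | succ n ih =>
    simp only [fwdDiff_iter_succ_eval]
    exact (ih _).sub (ih _)

lemma Differentiable.hasDerivAt_fwdDiff_iter {g : ℝ → ℝ} (hg : Differentiable ℝ g) (h : ℝ) (n : ℕ)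
    (x : ℝ) : HasDerivAt ((fwdDiff h)^[n] g) ((fwdDiff h)^[n] (_root_.deriv g) x) x := by
  induction n generalizing x with
  | zero => exact (hg x).hasDerivAt
  | succ n ih =>
    have he : (fwdDiff h)^[n + 1] g =
        fun y => (fwdDiff h)^[n] g (y + h) - (fwdDiff h)^[n] g y := by
      rw [Function.iterate_succ_apply']
      rfl
    rw [fwdDiff_iter_succ_eval, he]
    exact ((ih (x + h)).comp_add_const x h).sub (ih x)

/-! ### Marchaud's inequality -/

/-- The operator `H ↦ H + H (· + h)` is `fwdDiff h + 2`; its `r`-th power is the constant `2 ^ r` up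
to terms divisible by `fwdDiff h`. -/
lemma abs_add_shift_iter_sub_le {H : ℝ → ℝ} {h M : ℝ} {r : ℕ} {x : ℝ}
    (hH : ∀ j < r, |fwdDiff h H (x + j * h)| ≤ M) :
    |(fun (G : ℝ → ℝ) y => G y + G (y + h))^[r] H x - 2 ^ r * H x| ≤ r * 2 ^ r * M := by
  induction r generalizing x with
  | zero => simp
  | succ r ih =>
    rw [Function.iterate_succ_apply']
    set S := (fun (G : ℝ → ℝ) y => G y + G (y + h))^[r] H
    have h1 : |S x - 2 ^ r * H x| ≤ r * 2 ^ r * M := ih fun j hj => hH j (by omega)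
    have h2 : |S (x + h) - 2 ^ r * H (x + h)| ≤ r * 2 ^ r * M := ih fun j hj => by
      have := hH (j + 1) (by omega)
      rwa [show x + ((j + 1 : ℕ) : ℝ) * h = x + h + j * h by push_cast; ring] at this
    have h3 : |H (x + h) - H x| ≤ M := by simpa [fwdDiff] using hH 0 (by omega)
    have h4 : 2 ^ r * |H (x + h) - H x| ≤ 2 ^ r * M := by gcongr
    have h5 : S x + S (x + h) - 2 ^ (r + 1) * H x = (S x - 2 ^ r * H x)
        + (S (x + h) - 2 ^ r * H (x + h)) + 2 ^ r * (H (x + h) - H x) := by ring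
    have hp : (0 : ℝ) < 2 ^ r := by positivity
    rw [h5]
    refine (abs_add_three _ _ _).trans ?_
    rw [abs_mul, abs_of_pos hp]
    have hM : 0 ≤ M := (abs_nonneg _).trans h3
    have : 0 ≤ 2 ^ r * M := by positivity
    push_cast
    rw [pow_succ]
    nlinarith

/-- The operator `fwdDiff (2 * h)` is `fwdDiff h` followed by `fwdDiff h + 2`, so its `r`-th power is
`2 ^ r` times that of `fwdDiff h` up to differences of order `r + 1`. -/
lemma abs_fwdDiff_iter_le_double {F : ℝ → ℝ} {h M : ℝ} {r : ℕ} {x : ℝ}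
    (hF : ∀ j < r, |(fwdDiff h)^[r + 1] F (x + j * h)| ≤ M) :
    |(fwdDiff h)^[r] F x| ≤ |(fwdDiff (2 * h))^[r] F x| / 2 ^ r + r * M := by
  have key : (fwdDiff (2 * h))^[r] F =
      (fun (G : ℝ → ℝ) y => G y + G (y + h))^[r] ((fwdDiff h)^[r] F) := by
    have hc : Function.Commute (fun (G : ℝ → ℝ) y => G y + G (y + h)) (fwdDiff h) := fun G => by
      ext y
      simp only [fwdDiff]
      ring
    have he : (fwdDiff (2 * h) : (ℝ → ℝ) → ℝ → ℝ) =
        (fun (G : ℝ → ℝ) y => G y + G (y + h)) ∘ fwdDiff h := by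
      ext G y
      simp only [fwdDiff, Function.comp, two_mul, add_assoc]
      ring
    rw [he, hc.comp_iterate]
    rfl
  have h1 := abs_add_shift_iter_sub_le (H := (fwdDiff h)^[r] F) (h := h) (M := M) (r := r) (x := x)
    fun j hj => by
      have := hF j hj
      rwa [Function.iterate_succ_apply'] at this
  rw [← key] at h1
  have hp : (0 : ℝ) < 2 ^ r := by positivity
  have h2 : 2 ^ r * |(fwdDiff h)^[r] F x| ≤ |(fwdDiff (2 * h))^[r] F x| + r * 2 ^ r * M := by
    rw [← abs_of_pos hp, ← abs_mul, abs_of_pos hp]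
    have := abs_sub_abs_le_abs_sub (2 ^ r * (fwdDiff h)^[r] F x) ((fwdDiff (2 * h))^[r] F x)
    rw [abs_sub_comm] at h1
    linarith
  rw [← sub_le_iff_le_add, le_div_iff₀ hp]
  linarith

/-- Induction on the scale: a property that holds for steps in `(h₀ / 2, h₀]` and passes from `2 * h`
to `h` holds on `(0, h₀]`. -/
lemma forall_of_doubling {P : ℝ → Prop} {h₀ : ℝ} (top : ∀ h, h₀ / 2 < h → h ≤ h₀ → P h)
    (double : ∀ h, 0 < h → 2 * h ≤ h₀ → P (2 * h) → P h) : ∀ h, 0 < h → h ≤ h₀ → P h := by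
  have H : ∀ n : ℕ, ∀ h, 0 < h → h₀ < 2 ^ n * h → h ≤ h₀ → P h := by
    intro n
    induction n with
    | zero => intro h _ h2 h3; simp at h2; linarith
    | succ n ih =>
      intro h h1 h2 h3
      rcases lt_or_ge (h₀ / 2) h with h4 | h4
      · exact top h h4 h3
      · exact double h h1 (by linarith) (ih _ (by linarith) (by rw [pow_succ] at h2; linarith)
          (by linarith))
  intro h h1 h2
  obtain ⟨n, hn⟩ := pow_unbounded_of_one_lt (h₀ / h) (one_lt_two (α := ℝ))
  exact H n h h1 (by rwa [div_lt_iff₀ h1] at hn) h2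

/-- A gauge on `(0, h₀]`: a nonnegative monotone function that grows by a factor at most `l` under
doubling of its argument. -/
structure IsGauge (w : ℝ → ℝ) (l h₀ : ℝ) : Prop where
  nonneg : ∀ h, 0 < h → h ≤ h₀ → 0 ≤ w h
  mono : ∀ h k, 0 < h → h ≤ k → k ≤ h₀ → w h ≤ w k
  double : ∀ h, 0 < h → 2 * h ≤ h₀ → w (2 * h) ≤ l * w h

lemma IsGauge.const_mul {w : ℝ → ℝ} {l h₀ K : ℝ} (hw : IsGauge w l h₀) (hK : 0 ≤ K) :
    IsGauge (fun h => K * w h) l h₀ where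
  nonneg h h1 h2 := mul_nonneg hK (hw.nonneg h h1 h2)
  mono h k h1 h2 h3 := mul_le_mul_of_nonneg_left (hw.mono h k h1 h2 h3) hK
  double h h1 h2 := by
    have := mul_le_mul_of_nonneg_left (hw.double h h1 h2) hK
    linarith

/-- Marchaud's inequality: if the gauge grows slower than `h ^ r`, then a bound by the gauge on the
differences of order `r + 1` passes to those of order `r`. -/
lemma marchaud {F : ℝ → ℝ} {w : ℝ → ℝ} {l h₀ a b : ℝ} {r : ℕ} (hl : l < 2 ^ r) (hl0 : 0 ≤ l)
    (hw : IsGauge w l h₀) (hF : ∀ x ∈ Set.Icc a (b + r * h₀), |F x| ≤ w h₀)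
    (hd : ∀ x ∈ Set.Icc a (b + r * h₀), ∀ h, 0 < h → h ≤ h₀ → |(fwdDiff h)^[r + 1] F x| ≤ w h) :
    ∀ x ∈ Set.Icc a b, ∀ h, 0 < h → h ≤ h₀ →
      |(fwdDiff h)^[r] F x| ≤ (2 ^ r * l + r / (1 - l / 2 ^ r)) * w h := by
  intro x hx
  have hp : (0 : ℝ) < 2 ^ r := by positivity
  have hθ : 0 < 1 - l / 2 ^ r := by
    rw [sub_pos, div_lt_one hp]; exact hl
  have hr : (0 : ℝ) ≤ r := by positivity
  have mem : ∀ h, 0 < h → h ≤ h₀ → ∀ j ≤ r, x + j * h ∈ Set.Icc a (b + r * h₀) := by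
    intro h h1 h2 j hj
    have hj' : (j : ℝ) ≤ r := by exact_mod_cast hj
    have : (j : ℝ) * h ≤ r * h₀ := by gcongr
    have : 0 ≤ (j : ℝ) * h := by positivity
    exact ⟨by linarith [hx.1], by linarith [hx.2]⟩
  set K := 2 ^ r * l + r / (1 - l / 2 ^ r) with hK
  refine forall_of_doubling ?_ ?_
  · intro h h1 h2
    have h0 : 0 < h := by linarith
    have e1 : |(fwdDiff h)^[r] F x| ≤ 2 ^ r * w h₀ := abs_fwdDiff_iter_le fun k hk => by
      rw [nsmul_eq_mul]
      exact hF _ (mem h h0 h2 k hk)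
    have e2 : w h₀ ≤ l * w (h₀ / 2) := by
      have := hw.double (h₀ / 2) (by linarith) (by linarith)
      rwa [mul_div_cancel₀ _ two_ne_zero] at this
    have e3 : w (h₀ / 2) ≤ w h := hw.mono _ _ (by linarith) h1.le h2
    have e4 : 0 ≤ r / (1 - l / 2 ^ r) * w h := mul_nonneg (by positivity) (hw.nonneg h h0 h2)
    calc |(fwdDiff h)^[r] F x| ≤ 2 ^ r * (l * w h) := by
          refine e1.trans ?_
          gcongr
          exact e2.trans (by gcongr)
      _ ≤ K * w h := by rw [hK]; linarith
  · intro h h1 h2 ih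
    have e1 := abs_fwdDiff_iter_le_double (F := F) (h := h) (M := w h) (r := r) (x := x)
      fun j hj => hd _ (mem h h1 (by linarith) j hj.le) h h1 (by linarith)
    have hK0 : 0 ≤ K := by positivity
    have hwh := hw.nonneg h h1 (by linarith)
    have e2 : |(fwdDiff (2 * h))^[r] F x| / 2 ^ r ≤ K * (l * w h) / 2 ^ r := by
      gcongr
      exact ih.trans (mul_le_mul_of_nonneg_left (hw.double h h1 h2) hK0)
    have e3 : r ≤ (1 - l / 2 ^ r) * K := by
      have : (1 - l / 2 ^ r) * (r / (1 - l / 2 ^ r)) = r := mul_div_cancel₀ _ hθ.ne'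
      have : 0 ≤ (1 - l / 2 ^ r) * (2 ^ r * l) := by positivity
      rw [hK]; linarith
    have e4 := mul_le_mul_of_nonneg_right e3 hwh
    have e5 : K * (l * w h) / 2 ^ r = l / 2 ^ r * K * w h := by ring
    rw [e5] at e2
    linarith

/-- Iterated Marchaud inequality down to second differences, with a constant depending only on the
initial order. -/
lemma exists_abs_fwdDiff_two_le (n : ℕ) : ∃ K : ℝ, 1 ≤ K ∧ ∀ (F w : ℝ → ℝ) (h₀ a b : ℝ), 0 ≤ h₀ →
    IsGauge w 3 h₀ → (∀ x ∈ Set.Icc a (b + (n + 2) ^ 2 * h₀), |F x| ≤ w h₀) →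
    (∀ x ∈ Set.Icc a (b + (n + 2) ^ 2 * h₀), ∀ h, 0 < h → h ≤ h₀ →
      |(fwdDiff h)^[n + 2] F x| ≤ w h) →
    ∀ x ∈ Set.Icc a b, ∀ h, 0 < h → h ≤ h₀ → |(fwdDiff h)^[2] F x| ≤ K * w h := by
  induction n with
  | zero =>
    refine ⟨1, le_rfl, fun F w h₀ a b h0 hw hF hd x hx h h1 h2 => ?_⟩
    rw [one_mul]
    refine hd x ⟨hx.1, hx.2.trans ?_⟩ h h1 h2
    have : 0 ≤ (((0 : ℕ) : ℝ) + 2) ^ 2 * h₀ := by positivity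
    linarith
  | succ n ih =>
    obtain ⟨K, hK, ih⟩ := ih
    have hlt : (3 : ℝ) < 2 ^ (n + 2) := by
      have : (1 : ℝ) ≤ 2 ^ n := one_le_pow₀ one_le_two
      rw [pow_add]; linarith
    have hp : (0 : ℝ) < 2 ^ (n + 2) := by positivity
    have hθ : (0 : ℝ) < 1 - 3 / 2 ^ (n + 2) := by
      rw [sub_pos, div_lt_one hp]; exact hlt
    set B : ℝ := 2 ^ (n + 2) * 3 + ((n + 2 : ℕ) : ℝ) / (1 - 3 / 2 ^ (n + 2)) with hB
    have hB1 : 1 ≤ B := by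
      have : (0 : ℝ) ≤ ((n + 2 : ℕ) : ℝ) / (1 - 3 / 2 ^ (n + 2)) := by positivity
      linarith
    refine ⟨K * B, one_le_mul_of_one_le_of_one_le hK hB1,
      fun F w h₀ a b h0 hw hF hd x hx h h1 h2 => ?_⟩
    have hsub : ∀ c ≤ b + (n + 2) ^ 2 * h₀ + ((n + 2 : ℕ) : ℝ) * h₀,
        c ≤ b + (((n + 1 : ℕ) : ℝ) + 2) ^ 2 * h₀ := by
      intro c hc
      push_cast at hc ⊢
      nlinarith [mul_nonneg (Nat.cast_nonneg (α := ℝ) n) h0]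
    have hm := marchaud (F := F) (a := a) (b := b + (n + 2) ^ 2 * h₀) hlt (by norm_num) hw
      (fun x hx => hF x ⟨hx.1, hsub _ hx.2⟩) (fun x hx => hd x ⟨hx.1, hsub _ hx.2⟩)
    rw [← hB] at hm
    have hpos : 0 ≤ w h₀ := hw.nonneg h₀ (h1.trans_le h2) le_rfl
    rw [mul_assoc]
    refine ih F (fun h => B * w h) h₀ a b h0 (hw.const_mul (by linarith)) (fun x hx => ?_) hm
      x hx h h1 h2
    refine (hF x ⟨hx.1, hsub _ (hx.2.trans (le_add_of_nonneg_right (by positivity)))⟩).trans ?_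
    nlinarith

/-! ### Interpolation: bounding a derivative by values and high-order differences -/

lemma isGauge_mul_sqrt {h : ℝ} (hh : 0 < h) :
    IsGauge (fun t => t * √(t * h)) 3 h where
  nonneg t h1 _ := by positivity
  mono s t h1 h2 _ := by
    have : 0 ≤ t := h1.le.trans h2
    gcongr
  double t h1 _ := by
    have h2 : √(2 * t * h) ≤ 3 / 2 * √(t * h) := by
      rw [mul_assoc, Real.sqrt_mul zero_le_two]
      gcongr
      rw [Real.sqrt_le_left (by norm_num)]
      norm_num
    nlinarith

lemma pow_add_two_le_mul_sqrt {t h : ℝ} (ht : 0 < t) (hth : t ≤ h) (q : ℕ) :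
    t ^ (q + 2) ≤ h ^ q * (t * √(t * h)) := by
  have h1 : t ≤ √(t * h) := by
    apply Real.le_sqrt_of_sq_le
    nlinarith
  have h2 : 0 ≤ h := ht.le.trans hth
  calc t ^ (q + 2) = t ^ q * (t * t) := by ring
    _ ≤ h ^ q * (t * √(t * h)) := by gcongr

lemma HasDerivAt.abs_le_of_abs_fwdDiff_le {F : ℝ → ℝ} {d y B h : ℝ} (hd : HasDerivAt F d y)
    (hh : 0 < h) (hF : ∀ t, 0 < t → t ≤ h → |fwdDiff t F y| ≤ B * t) : |d| ≤ B := by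
  have h1 : Tendsto (fun t : ℝ => |t⁻¹ • (F (y + t) - F y)|) (𝓝[>] 0) (𝓝 |d|) :=
    hd.tendsto_slope_zero_right.abs
  refine le_of_tendsto h1 ?_
  filter_upwards [Ioc_mem_nhdsGT hh] with t ht
  have := hF t ht.1 ht.2
  rw [fwdDiff] at this
  rw [smul_eq_mul, abs_mul, abs_inv, abs_of_pos ht.1, inv_mul_le_iff₀ ht.1]
  linarith

/-- A Landau–Kolmogorov type inequality at scale `h`: a function of size `A h ^ (q + 2)` whose
high-order differences with step `t ≤ h` are at most `A t ^ (q + 2)` has derivative of size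
`A h ^ (q + 1)`. -/
lemma exists_abs_deriv_le (n : ℕ) : ∃ K : ℝ, 0 ≤ K ∧ ∀ (F : ℝ → ℝ) (A h y d : ℝ) (q : ℕ),
    0 ≤ A → 0 < h → h ≤ 1 →
    (∀ z ∈ Set.Icc y (y + (n + 2) ^ 2), |F z| ≤ A * h ^ (q + 2)) →
    (∀ z ∈ Set.Icc y (y + (n + 2) ^ 2), ∀ t, 0 < t → t ≤ h →
      |(fwdDiff t)^[n + 2] F z| ≤ A * t ^ (q + 2)) →
    HasDerivAt F d y → |d| ≤ K * A * h ^ (q + 1) := by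
  obtain ⟨K, hK, hdesc⟩ := exists_abs_fwdDiff_two_le n
  refine ⟨3 * K + 4, by linarith, fun F A h y d q hA hh h1 hF hN hd => ?_⟩
  have hsub : ∀ z ∈ Set.Icc y (y + (n + 2) ^ 2 * h), z ∈ Set.Icc y (y + (n + 2) ^ 2) := by
    intro z hz
    refine ⟨hz.1, hz.2.trans ?_⟩
    have : ((n : ℝ) + 2) ^ 2 * h ≤ (n + 2) ^ 2 * 1 := by gcongr
    linarith
  have hAq : 0 ≤ A * h ^ q := by positivity
  have h2 := hdesc F (fun t => A * h ^ q * (t * √(t * h))) h y y hh.le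
    ((isGauge_mul_sqrt hh).const_mul hAq)
    (fun z hz => by
      refine (hF z (hsub z hz)).trans_eq ?_
      rw [Real.sqrt_mul_self hh.le]
      ring)
    (fun z hz t ht hth => by
      refine (hN z (hsub z hz) t ht hth).trans ?_
      rw [mul_assoc]
      gcongr
      exact pow_add_two_le_mul_sqrt ht hth q)
    y ⟨le_rfl, le_rfl⟩
  -- The correction term `- 3 K t √(t h)` absorbs the second differences in the doubling step.
  have h3 : ∀ t, 0 < t → t ≤ h → |fwdDiff t F y| ≤
      A * h ^ q * ((3 * K + 4) * (t * h) - 3 * K * (t * √(t * h))) := by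
    refine forall_of_doubling (fun t ht hth => ?_) (fun t ht hth ih => ?_)
    · have ht0 : 0 < t := by linarith
      have e1 : |(fwdDiff t)^[1] F y| ≤ 2 ^ 1 * (A * h ^ (q + 2)) :=
        abs_fwdDiff_iter_le fun k hk => hF _ (by
          have hk' : (k : ℝ) ≤ 1 := by exact_mod_cast hk
          have : (k : ℝ) * t ≤ 1 * 1 := by gcongr; linarith
          have : 0 ≤ (k : ℝ) * t := by positivity
          rw [nsmul_eq_mul]
          refine ⟨by linarith, ?_⟩
          nlinarith [Nat.cast_nonneg (α := ℝ) n])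
      have e2 : √(t * h) ≤ h := by
        rw [Real.sqrt_le_left hh.le]; nlinarith
      have e3 : 3 * K * (t * √(t * h)) ≤ 3 * K * (t * h) := by gcongr
      have e4 : 2 * h ^ 2 ≤ (3 * K + 4) * (t * h) - 3 * K * (t * √(t * h)) := by nlinarith
      refine e1.trans ?_
      calc 2 ^ 1 * (A * h ^ (q + 2)) = A * h ^ q * (2 * h ^ 2) := by ring
        _ ≤ _ := by gcongr
    · have e1 := abs_fwdDiff_iter_le_double (F := F) (h := t) (r := 1) (x := y) fun j hj => by
        obtain rfl : j = 0 := by omega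
        simpa using h2 t ht (by linarith)
      rw [Function.iterate_one, Function.iterate_one, Nat.cast_one, one_mul, pow_one] at e1
      have e2 : 4 / 3 * √(t * h) ≤ √(2 * t * h) := by
        rw [mul_assoc, Real.sqrt_mul zero_le_two]
        gcongr
        apply Real.le_sqrt_of_sq_le
        norm_num
      have e3 : 4 / 3 * (K * t * √(t * h)) ≤ K * t * √(2 * t * h) := by
        have : 0 ≤ K * t := by positivity
        nlinarith
      refine e1.trans ?_
      calc _ ≤ A * h ^ q * ((3 * K + 4) * (2 * t * h) - 3 * K * (2 * t * √(2 * t * h))) / 2 +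
            K * (A * h ^ q * (t * √(t * h))) := by gcongr
        _ = A * h ^ q * ((3 * K + 4) * (t * h) - 3 * (K * t * √(2 * t * h)) +
            K * t * √(t * h)) := by ring
        _ ≤ _ := by
          gcongr
          linarith
  refine hd.abs_le_of_abs_fwdDiff_le hh fun t ht hth => (h3 t ht hth).trans ?_
  have : 0 ≤ 3 * K * (t * √(t * h)) := by positivity
  calc _ ≤ A * h ^ q * ((3 * K + 4) * (t * h)) := by gcongr; linarith
    _ = _ := by ring

/-! ### One-dimensional Zygmund classes via differences -/

/-- `g` is locally bounded and its differences of order `N` with step `h ∈ (0, 1]` are locally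
`O(h ^ p)`. -/
def LocallyDiffBounded (N p : ℕ) (g : ℝ → ℝ) : Prop :=
  ∀ R : ℝ, ∃ C : ℝ, 0 ≤ C ∧ ∀ x ∈ Set.Icc (-R) R, |g x| ≤ C ∧
    ∀ h, 0 < h → h ≤ 1 → |(fwdDiff h)^[N] g x| ≤ C * h ^ p

/-- The iterated Marchaud inequality on the interval `[-R, R]` at unit scale. -/
lemma LocallyDiffBounded.two_of_gauge {n p : ℕ} {g : ℝ → ℝ} (hg : LocallyDiffBounded (n + 2) p g)
    {w : ℝ → ℝ} (hw : IsGauge w 3 1) (hw1 : w 1 = 1)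
    (hp : ∀ h, 0 < h → h ≤ 1 → h ^ p ≤ w h) (R : ℝ) :
    ∃ C, 0 ≤ C ∧ ∀ x ∈ Set.Icc (-R) R, |g x| ≤ C ∧
      ∀ h, 0 < h → h ≤ 1 → |(fwdDiff h)^[2] g x| ≤ C * w h := by
  obtain ⟨K, hK, hdesc⟩ := exists_abs_fwdDiff_two_le n
  obtain ⟨C, hC, hg⟩ := hg (R + (n + 2) ^ 2 * 1)
  have hmem : ∀ x ∈ Set.Icc (-R) (R + ((n : ℝ) + 2) ^ 2 * 1),
      x ∈ Set.Icc (-(R + ((n : ℝ) + 2) ^ 2 * 1)) (R + (n + 2) ^ 2 * 1) := fun x hx => by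
    have : 0 ≤ ((n : ℝ) + 2) ^ 2 * 1 := by positivity
    exact ⟨by linarith [hx.1], hx.2⟩
  refine ⟨K * C, by positivity, fun x hx => ⟨?_, ?_⟩⟩
  · have : 0 ≤ ((n : ℝ) + 2) ^ 2 * 1 := by positivity
    refine (hg x (hmem x ⟨hx.1, by linarith [hx.2]⟩)).1.trans ?_
    nlinarith
  · simp only [mul_assoc K C]
    refine hdesc g (fun h => C * w h) 1 (-R) R zero_le_one (hw.const_mul hC) (fun x hx => ?_)
      (fun x hx h h1 h2 => ?_) x hx
    · simpa [hw1] using (hg x (hmem x hx)).1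
    · exact ((hg x (hmem x hx)).2 h h1 h2).trans (by gcongr; exact hp h h1 h2)

lemma isGauge_id : IsGauge (fun h => h) 3 1 where
  nonneg h h1 _ := h1.le
  mono h k _ h2 _ := h2
  double h h1 _ := by linarith

lemma isGauge_sqrt : IsGauge Real.sqrt (3 / 2) 1 where
  nonneg h _ _ := Real.sqrt_nonneg h
  mono h k _ h2 _ := Real.sqrt_le_sqrt h2
  double h h1 _ := by
    rw [Real.sqrt_mul zero_le_two]
    gcongr
    rw [Real.sqrt_le_left (by norm_num)]
    norm_num

lemma continuous_of_abs_fwdDiff_two_le {g : ℝ → ℝ}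
    (hg : ∀ R : ℝ, ∃ C, 0 ≤ C ∧ ∀ x ∈ Set.Icc (-R) R, |g x| ≤ C ∧
      ∀ h, 0 < h → h ≤ 1 → |(fwdDiff h)^[2] g x| ≤ C * h) : Continuous g := by
  -- First differences are locally `O(√h)`.
  have key : ∀ R : ℝ, ∃ C, ∀ x ∈ Set.Icc (-R) R, ∀ h, 0 ≤ h → h ≤ 1 →
      |g (x + h) - g x| ≤ C * √h := by
    intro R
    obtain ⟨C, hC, hg⟩ := hg (R + (1 : ℕ) * 1)
    have hmem : ∀ x ∈ Set.Icc (-R) (R + (1 : ℕ) * (1 : ℝ)),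
        x ∈ Set.Icc (-(R + (1 : ℕ) * (1 : ℝ))) (R + (1 : ℕ) * 1) := fun x hx => by
      have : (0 : ℝ) ≤ (1 : ℕ) * 1 := by norm_num
      exact ⟨by linarith [hx.1], hx.2⟩
    have hm := marchaud (F := g) (w := fun h => C * √h) (r := 1) (a := -R) (b := R) (h₀ := 1)
      (by norm_num) (by norm_num) (isGauge_sqrt.const_mul hC)
      (fun x hx => by simpa using (hg x (hmem x hx)).1)
      (fun x hx h h1 h2 => ((hg x (hmem x hx)).2 h h1 h2).trans (by
        gcongr
        apply Real.le_sqrt_of_sq_le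
        nlinarith))
    simp only [← mul_assoc] at hm
    refine ⟨(2 ^ 1 * (3 / 2) + (1 : ℕ) / (1 - 3 / 2 / 2 ^ 1)) * C, fun x hx h h0 h1 => ?_⟩
    rcases h0.eq_or_lt with rfl | h0
    · simp
    · exact hm x hx h h0 h1
  rw [continuous_iff_continuousAt]
  intro x
  obtain ⟨C, hC⟩ := key (|x| + 1)
  rw [ContinuousAt, tendsto_iff_dist_tendsto_zero]
  have hlim : Tendsto (fun y => C * √|y - x|) (𝓝 x) (𝓝 0) := by
    have : Continuous fun y => C * √|y - x| := by fun_prop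
    simpa using this.tendsto x
  refine squeeze_zero' (Eventually.of_forall fun _ => dist_nonneg) ?_ hlim
  filter_upwards [Metric.ball_mem_nhds x one_pos] with y hy
  rw [Metric.mem_ball, Real.dist_eq] at hy
  rw [Real.dist_eq]
  have hx1 := neg_abs_le x
  have hx2 := le_abs_self x
  obtain ⟨hy1, hy2⟩ := abs_lt.1 hy
  rcases le_total x y with h | h
  · have := hC x ⟨by linarith, by linarith⟩ (y - x) (by linarith) (by linarith)
    rw [add_sub_cancel] at this
    rwa [abs_of_nonneg (sub_nonneg.2 h)]
  · have := hC y ⟨by linarith, by linarith⟩ (x - y) (by linarith) (by linarith)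
    rw [add_sub_cancel] at this
    rwa [abs_sub_comm, abs_sub_comm y x, abs_of_nonneg (sub_nonneg.2 h)]

/-- The dyadic difference quotients converge locally uniformly; they are the derivatives of the
Steklov averages of `g`, which converge to `g`. -/
lemma differentiable_of_abs_fwdDiff_two_le {g : ℝ → ℝ} (hc : Continuous g)
    (hg : ∀ R : ℝ, ∃ C, 0 ≤ C ∧ ∀ x ∈ Set.Icc (-R) R,
      ∀ h, 0 < h → h ≤ 1 → |(fwdDiff h)^[2] g x| ≤ C * (h * √h)) : Differentiable ℝ g := by
  intro x₀
  obtain ⟨C, hC, hg⟩ := hg (|x₀| + 1)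
  set s : Set ℝ := Set.Ioo (-(|x₀| + 1)) (|x₀| + 1) with hs
  set e : ℕ → ℝ := fun n => (1 / 2) ^ n with he
  have he0 : ∀ n, 0 < e n := fun n => by positivity
  set q : ℕ → ℝ → ℝ := fun n x => (e n)⁻¹ * (g (x + e n) - g x) with hq
  set r : ℝ := √(1 / 2) with hr
  have hr0 : 0 ≤ r := Real.sqrt_nonneg _
  have hr1 : r < 1 := by rw [hr, Real.sqrt_lt' one_pos]; norm_num
  have hqd : ∀ x ∈ s, ∀ n, dist (q n x) (q (n + 1) x) ≤ C * r ^ n := by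
    intro x hx n
    have h1 : e n = 2 * e (n + 1) := by simp only [he, pow_succ]; ring
    have h2 := hg x ⟨hx.1.le, hx.2.le⟩ (e (n + 1)) (he0 _)
      (pow_le_one₀ (by norm_num) (by norm_num))
    set h := e (n + 1)
    have hh : 0 < h := he0 _
    have h3 : q n x - q (n + 1) x = (2 * h)⁻¹ * (fwdDiff h)^[2] g x := by
      simp only [hq, h1, fwdDiff_iter_succ_eval, Function.iterate_zero, id_eq]
      change (2 * h)⁻¹ * (g (x + 2 * h) - g x) - h⁻¹ * (g (x + h) - g x) = _
      rw [show x + h + h = x + 2 * h by ring]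
      field_simp
      ring
    have h4 : √h = r * r ^ n := by
      rw [← pow_succ', hr, Real.sqrt_eq_iff_mul_self_eq (by positivity) (by positivity),
        ← mul_pow, Real.mul_self_sqrt (by norm_num)]
    rw [Real.dist_eq, h3, abs_mul, abs_of_pos (by positivity), inv_mul_le_iff₀ (by positivity)]
    refine h2.trans ?_
    rw [h4]
    have : C * (h * (r * r ^ n)) ≤ C * (h * (1 * r ^ n)) := by gcongr
    have : 0 ≤ C * (h * r ^ n) := by positivity
    linarith
  set L : ℝ → ℝ := fun x => limUnder atTop fun n => q n x
  have hL : ∀ x ∈ s, Tendsto (fun n => q n x) atTop (𝓝 (L x)) := fun x hx =>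
    tendsto_nhds_limUnder <| cauchySeq_tendsto_of_complete <|
      cauchySeq_of_le_geometric r C hr1 (hqd x hx)
  have hu : TendstoUniformlyOn q L atTop s := by
    rw [Metric.tendstoUniformlyOn_iff]
    intro ε hε
    have : Tendsto (fun n => C * r ^ n / (1 - r)) atTop (𝓝 0) := by
      simpa using ((tendsto_pow_atTop_nhds_zero_of_lt_one hr0 hr1).const_mul C).div_const (1 - r)
    filter_upwards [this.eventually_lt_const hε] with n hn x hx
    rw [dist_comm]
    exact (dist_le_of_le_geometric_of_tendsto r C hr1 (hqd x hx) (hL x hx) n).trans_lt hn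
  set Φ : ℝ → ℝ := fun x => ∫ t in (0 : ℝ)..x, g t
  have hΦ : ∀ x, HasDerivAt Φ (g x) x := fun x => (hc.integral_hasStrictDerivAt 0 x).hasDerivAt
  have het : Tendsto e atTop (𝓝[>] 0) := by
    rw [tendsto_nhdsWithin_iff]
    exact ⟨tendsto_pow_atTop_nhds_zero_of_lt_one (by norm_num) (by norm_num),
      Eventually.of_forall he0⟩
  have hmem : x₀ ∈ s := ⟨by linarith [neg_abs_le x₀], by linarith [le_abs_self x₀]⟩
  refine (hasDerivAt_of_tendstoUniformlyOn (f := fun n x => (e n)⁻¹ * (Φ (x + e n) - Φ x))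
    isOpen_Ioo hu (Eventually.of_forall fun n x _ => ?_) (fun x _ => ?_) hmem).differentiableAt
  · exact (((hΦ (x + e n)).comp_add_const x (e n)).sub (hΦ x)).const_mul _
  · exact (hΦ x).tendsto_slope_zero_right.comp het

lemma isZygmund_succ_iff {p : ℕ} {g : ℝ → ℝ} :
    IsZygmund (p + 1) g ↔ Differentiable ℝ g ∧ IsZygmund p (deriv g) := by
  have h : ContDiff ℝ ((p + 1 : ℕ) : WithTop ℕ∞) g ↔
      Differentiable ℝ g ∧ ContDiff ℝ (p : WithTop ℕ∞) (deriv g) := by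
    rw [Nat.cast_add, Nat.cast_one, contDiff_succ_iff_deriv]
    simp
  rw [IsZygmund, IsZygmund, h, iteratedDeriv_succ', and_assoc]

lemma isZygmundZero_of_abs_fwdDiff_two_le {g : ℝ → ℝ}
    (hg : ∀ R : ℝ, ∃ C, 0 ≤ C ∧ ∀ x ∈ Set.Icc (-R) R, |g x| ≤ C ∧
      ∀ h, 0 < h → h ≤ 1 → |(fwdDiff h)^[2] g x| ≤ C * h) : IsZygmundZero g := by
  refine ⟨continuous_of_abs_fwdDiff_two_le hg, fun K hK => ?_⟩
  obtain ⟨R, hR⟩ := hK.isBounded.subset_closedBall 0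
  obtain ⟨C, hC, hg⟩ := hg R
  have hmem : ∀ x ∈ K, x ∈ Set.Icc (-R) R := fun x hx => by
    have := hR hx
    rwa [Real.closedBall_eq_Icc, zero_sub, zero_add] at this
  have pos : ∀ x h, x ∈ K → x + h ∈ K → x - h ∈ K → 0 < h →
      |g (x + h) - 2 * g x + g (x - h)| ≤ 4 * C * h := by
    intro x h hx hxp hxm hh
    rcases le_or_gt h 1 with h1 | h1
    · have := (hg _ (hmem _ hxm)).2 h hh h1
      simp only [fwdDiff_iter_succ_eval, Function.iterate_zero, id_eq, sub_add_cancel] at this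
      rw [show g (x + h) - g x - (g x - g (x - h)) = g (x + h) - 2 * g x + g (x - h) by ring]
        at this
      refine this.trans ?_
      have : 0 ≤ C * h := by positivity
      linarith
    · have e1 := abs_le.1 (hg _ (hmem _ hx)).1
      have e2 := abs_le.1 (hg _ (hmem _ hxp)).1
      have e3 := abs_le.1 (hg _ (hmem _ hxm)).1
      have e4 : 4 * C ≤ 4 * C * h := le_mul_of_one_le_right (by linarith) h1.le
      rw [abs_le]
      constructor <;> linarith
  refine ⟨4 * C, fun x h hx hxp hxm hh => ?_⟩
  rw [div_le_iff₀ (abs_pos.2 hh)]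
  rcases lt_or_gt_of_ne hh with hh | hh
  · have := pos x (-h) hx (by rwa [← sub_eq_add_neg]) (by rwa [sub_neg_eq_add]) (by linarith)
    rw [← sub_eq_add_neg, sub_neg_eq_add] at this
    rwa [abs_of_neg hh, show g (x + h) - 2 * g x + g (x - h) =
      g (x - h) - 2 * g x + g (x + h) by ring]
  · rw [abs_of_pos hh]
    exact pos x h hx hxp hxm hh

/-- The `(n + 2)`-th difference of `g` with step `h` has size `h ^ (p + 2)`, and so have its own
differences in terms of their step; interpolation at scale `h` bounds its derivative. -/
lemma LocallyDiffBounded.deriv {n p : ℕ} {g : ℝ → ℝ}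
    (hg : LocallyDiffBounded (n + 2) (p + 2) g) (hd : Differentiable ℝ g) :
    LocallyDiffBounded (n + 2) (p + 1) (deriv g) := by
  obtain ⟨K, hK, hint⟩ := exists_abs_deriv_le n
  intro R
  obtain ⟨C, hC, hg⟩ := hg (R + (n + 2) ^ 2 + (n + 2))
  have hmem : ∀ x ∈ Set.Icc (-R) R, ∀ z ∈ Set.Icc x (x + ((n : ℝ) + 2) ^ 2),
      ∀ k ≤ n + 2, ∀ h : ℝ, 0 < h → h ≤ 1 → z + k • h ∈
        Set.Icc (-(R + ((n : ℝ) + 2) ^ 2 + (n + 2))) (R + (n + 2) ^ 2 + (n + 2)) := by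
    intro x hx z hz k hk h h0 h1
    have hk' : (k : ℝ) ≤ n + 2 := by exact_mod_cast hk
    have e1 : (k : ℝ) * h ≤ (n + 2) * 1 := by gcongr
    have e2 : 0 ≤ (k : ℝ) * h := by positivity
    have e3 : 0 ≤ ((n : ℝ) + 2) ^ 2 := by positivity
    rw [nsmul_eq_mul]
    exact ⟨by linarith [hx.1, hz.1, Nat.cast_nonneg (α := ℝ) n], by linarith [hx.2, hz.2]⟩
  have hmem' : ∀ x ∈ Set.Icc (-R) R, ∀ z ∈ Set.Icc x (x + ((n : ℝ) + 2) ^ 2), z ∈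
        Set.Icc (-(R + ((n : ℝ) + 2) ^ 2 + (n + 2))) (R + (n + 2) ^ 2 + (n + 2)) := by
    intro x hx z hz
    simpa using hmem x hx z hz 0 (by omega) 1 one_pos le_rfl
  have h2 : (1 : ℝ) ≤ 2 ^ (n + 2) := one_le_pow₀ one_le_two
  refine ⟨K * (2 ^ (n + 2) * C), by positivity, fun x hx => ⟨?_, fun h h0 h1 => ?_⟩⟩
  · have := hint g (2 ^ (n + 2) * C) 1 x (_root_.deriv g x) p (by positivity) one_pos le_rfl
      (fun z hz => by
        rw [one_pow, mul_one]
        exact (hg z (hmem' x hx z hz)).1.trans (le_mul_of_one_le_left hC h2))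
      (fun z hz t ht ht1 => by
        refine ((hg z (hmem' x hx z hz)).2 t ht ht1).trans ?_
        gcongr
        exact le_mul_of_one_le_left hC h2)
      (hd x).hasDerivAt
    simpa using this
  · refine hint ((fwdDiff h)^[n + 2] g) (2 ^ (n + 2) * C) h x _ p (by positivity) h0 h1
      (fun z hz => ?_) (fun z hz t ht hth => ?_) ?_
    · refine ((hg z (hmem' x hx z hz)).2 h h0 h1).trans ?_
      gcongr
      exact le_mul_of_one_le_left hC h2
    · rw [fwdDiff_iter_comm, mul_assoc]
      exact abs_fwdDiff_iter_le fun k hk =>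
        (hg _ (hmem x hx z hz k hk h h0 h1)).2 t ht (hth.trans h1)
    · exact hd.hasDerivAt_fwdDiff_iter h (n + 2) x

/-- The converse direction of the difference characterization of Zygmund classes. -/
theorem LocallyDiffBounded.isZygmund {n p : ℕ} {g : ℝ → ℝ}
    (hg : LocallyDiffBounded (n + 2) (p + 1) g) : IsZygmund p g := by
  induction p generalizing g with
  | zero =>
    have h := isZygmundZero_of_abs_fwdDiff_two_le
      (hg.two_of_gauge isGauge_id rfl fun h h1 h2 => by simp)
    exact ⟨by simpa using h.1, by simpa using h⟩
  | succ p ih =>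
    have hc : Continuous g := continuous_of_abs_fwdDiff_two_le
      (hg.two_of_gauge isGauge_id rfl fun h h1 h2 => pow_le_of_le_one h1.le h2 (by omega))
    have hd : Differentiable ℝ g := by
      refine differentiable_of_abs_fwdDiff_two_le hc fun R => ?_
      obtain ⟨C, hC, h⟩ := hg.two_of_gauge (isGauge_mul_sqrt one_pos) (by simp)
        (fun h h1 h2 => by simpa using pow_add_two_le_mul_sqrt h1 h2 p) R
      exact ⟨C, hC, fun x hx => by simpa using (h x hx).2⟩
    exact isZygmund_succ_iff.2 ⟨hd, ih (hg.deriv hd)⟩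

/-- The forward direction of the difference characterization of Zygmund classes. -/
theorem IsZygmund.locallyDiffBounded {m : ℕ} {g : ℝ → ℝ} (hg : IsZygmund m g) :
    LocallyDiffBounded (m + 2) (m + 1) g := by
  suffices H : ∀ R : ℝ, ∃ C : ℝ, 0 ≤ C ∧ ∀ x ∈ Set.Icc (-R) R, ∀ h, 0 < h → h ≤ 1 →
      |(fwdDiff h)^[m + 2] g x| ≤ C * h ^ (m + 1) by
    intro R
    obtain ⟨C, hC, h⟩ := H R
    obtain ⟨C', h'⟩ := isCompact_Icc (a := -R) (b := R) |>.exists_bound_of_continuousOn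
      hg.1.continuous.continuousOn
    refine ⟨max C C', le_max_of_le_left hC, fun x hx => ⟨(h' x hx).trans (le_max_right _ _),
      fun t h0 h1 => (h x hx t h0 h1).trans ?_⟩⟩
    gcongr
    exact le_max_left _ _
  induction m generalizing g with
  | zero =>
    intro R
    obtain ⟨C, hC⟩ := hg.2.2 (Set.Icc (-R) (R + 2)) isCompact_Icc
    refine ⟨max C 0, le_max_right _ _, fun x hx h h0 h1 => ?_⟩
    have := hC (x + h) h ⟨by linarith [hx.1], by linarith [hx.2]⟩
      ⟨by linarith [hx.1], by linarith [hx.2]⟩ ⟨by linarith [hx.1], by linarith [hx.2]⟩ h0.ne'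
    rw [iteratedDeriv_zero, div_le_iff₀ (abs_pos.2 h0.ne'), abs_of_pos h0,
      add_sub_cancel_right] at this
    simp only [fwdDiff_iter_succ_eval, Function.iterate_zero, id_eq]
    rw [show g (x + h + h) - g (x + h) - (g (x + h) - g x) =
      g (x + h + h) - 2 * g (x + h) + g x by ring, zero_add, pow_one]
    refine this.trans ?_
    gcongr
    exact le_max_left _ _
  | succ m ih =>
    obtain ⟨hd, hz⟩ := isZygmund_succ_iff.1 hg
    intro R
    obtain ⟨C, hC, h⟩ := ih hz (R + 1)
    refine ⟨C, hC, fun x hx t h0 h1 => ?_⟩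
    have := (convex_Icc x (x + t)).norm_image_sub_le_of_norm_hasDerivWithin_le
      (C := C * t ^ (m + 1))
      (fun y _ => (hd.hasDerivAt_fwdDiff_iter t (m + 2) y).hasDerivWithinAt)
      (fun y hy => h y ⟨by linarith [hx.1, hy.1], by linarith [hx.2, hy.2]⟩ t h0 h1)
      (Set.left_mem_Icc.2 (by linarith)) (Set.right_mem_Icc.2 (by linarith))
    rw [fwdDiff_iter_succ_eval]
    rw [Real.norm_eq_abs, add_sub_cancel_left, Real.norm_eq_abs, abs_of_pos h0] at this
    exact this.trans_eq (by ring)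

/-! ### Smooth curves through fast converging sequences -/

lemma exists_forall_norm_iteratedFDeriv_le {u : ℝ → ℝ} (hu : ContDiff ℝ ∞ u)
    (hc : HasCompactSupport u) (n : ℕ) :
    ∃ M, 0 ≤ M ∧ ∀ k ≤ n, ∀ x, ‖iteratedFDeriv ℝ k u x‖ ≤ M := by
  have : ∀ k : ℕ, ∃ M, ∀ x, ‖iteratedFDeriv ℝ k u x‖ ≤ M := fun k =>
    (hu.continuous_iteratedFDeriv (mod_cast le_top)).bounded_above_of_compact_support
      (hc.iteratedFDeriv k)
  choose M hM using this
  have h0 : ∀ k, 0 ≤ M k := fun k => (norm_nonneg _).trans (hM k 0)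
  refine ⟨∑ k ∈ Finset.range (n + 1), M k, Finset.sum_nonneg fun k _ => h0 k, fun k hk x => ?_⟩
  exact (hM k x).trans (Finset.single_le_sum (fun i _ => h0 i)
    (Finset.mem_range.2 (Nat.lt_succ_of_le hk)))

lemma norm_iteratedFDeriv_smul_const_le {E : Type*} [NormedAddCommGroup E] [NormedSpace ℝ E]
    {u : ℝ → ℝ} (hu : ContDiff ℝ ∞ u) (a : E) (k : ℕ) (x : ℝ) :
    ‖iteratedFDeriv ℝ k (fun s => u s • a) x‖ ≤ ‖a‖ * ‖iteratedFDeriv ℝ k u x‖ := by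
  have := (ContinuousLinearMap.toSpanSingleton ℝ a).norm_iteratedFDeriv_comp_left
    (n := k) (hu.contDiffAt (x := x)) (mod_cast le_top)
  rwa [ContinuousLinearMap.norm_toSpanSingleton] at this

/-- A version of the special curve lemma with affine pieces. There are base points `t n` in
`[0, 1]`, lengths `δ n` and speeds `ε n` such that for any points `a n` converging to `p` at rate
`ε n` some smooth curve equals `a n + (ε n * s) • v` at time `t n + s` for `|s| ≤ δ n`. -/
lemma exists_contDiff_curve_affine_pieces (E : Type*) [NormedAddCommGroup E] [NormedSpace ℝ E]
    [CompleteSpace E] :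
    ∃ t δ ε : ℕ → ℝ, (∀ n, t n ∈ Set.Icc 0 1) ∧ (∀ n, 0 < δ n) ∧ (∀ n, 0 < ε n) ∧
      ∀ (p v : E) (a : ℕ → E), ‖v‖ ≤ 1 → (∀ n, ‖a n - p‖ ≤ ε n) →
        ∃ c : ℝ → E, ContDiff ℝ ∞ c ∧
          ∀ n s, |s| ≤ δ n → c (t n + s) = a n + (ε n * s) • v := by
  set t : ℕ → ℝ := fun n => (1 / 2) ^ n with ht
  have ht0 : ∀ n, 0 < t n := fun n => by positivity
  let β : ∀ n, ContDiffBump (t n) := fun n =>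
    { rIn := t n / 8
      rOut := t n / 4
      rIn_pos := by linarith [ht0 n]
      rIn_lt_rOut := by linarith [ht0 n] }
  let u : ℕ → ℝ → ℝ := fun n s => β n s
  let w : ℕ → ℝ → ℝ := fun n s => β n s * (s - t n)
  have hu : ∀ n, ContDiff ℝ ∞ (u n) := fun n => (β n).contDiff
  have hw : ∀ n, ContDiff ℝ ∞ (w n) := fun n =>
    (β n).contDiff.mul (contDiff_id.sub contDiff_const)
  choose M hM0 hM using fun n =>
    exists_forall_norm_iteratedFDeriv_le (hu n) (β n).hasCompactSupport n
  choose M' hM0' hM' using fun n =>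
    exists_forall_norm_iteratedFDeriv_le (hw n) ((β n).hasCompactSupport.mul_right) n
  -- The speed `ε n` makes all derivatives of order at most `n` of the `n`-th piece small.
  set ε : ℕ → ℝ := fun n => (1 / 2) ^ n / (M n + M' n + 1) with hε
  have hε0 : ∀ n, 0 < ε n := fun n => by
    have := hM0 n
    have := hM0' n
    positivity
  refine ⟨t, fun n => t n / 8, ε, fun n => ⟨(ht0 n).le, pow_le_one₀ (by norm_num) (by norm_num)⟩,
    fun n => by linarith [ht0 n], hε0, fun p v a hv ha => ?_⟩
  let term : ℕ → ℝ → E := fun n s => u n s • (a n - p) + w n s • (ε n • v)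
  have hterm : ∀ n, ContDiff ℝ ∞ (term n) := fun n =>
    ((hu n).smul contDiff_const).add ((hw n).smul contDiff_const)
  have hbound : ∀ k n, k ≤ n → ∀ x, ‖iteratedFDeriv ℝ k (term n) x‖ ≤ (1 / 2) ^ n := by
    intro k n hkn x
    have h1 : iteratedFDeriv ℝ k (term n) x = iteratedFDeriv ℝ k (fun s => u n s • (a n - p)) x +
        iteratedFDeriv ℝ k (fun s => w n s • (ε n • v)) x :=
      iteratedFDeriv_add_apply
        (((hu n).smul contDiff_const).contDiffAt.of_le (mod_cast le_top))
        (((hw n).smul contDiff_const).contDiffAt.of_le (mod_cast le_top))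
    have h2 : ‖ε n • v‖ ≤ ε n := by
      rw [norm_smul, Real.norm_of_nonneg (hε0 n).le]
      exact mul_le_of_le_one_right (hε0 n).le hv
    have h3 := hM0 n
    have h4 := hM0' n
    rw [h1]
    calc _ ≤ ‖a n - p‖ * ‖iteratedFDeriv ℝ k (u n) x‖ +
          ‖ε n • v‖ * ‖iteratedFDeriv ℝ k (w n) x‖ :=
        norm_add_le_of_le (norm_iteratedFDeriv_smul_const_le (hu n) _ _ _)
          (norm_iteratedFDeriv_smul_const_le (hw n) _ _ _)
      _ ≤ ε n * M n + ε n * M' n := by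
        gcongr
        · exact ha n
        · exact hM n k hkn x
        · exact hM' n k hkn x
      _ ≤ ε n * (M n + M' n + 1) := by linarith [hε0 n]
      _ = (1 / 2) ^ n := by rw [hε]; field_simp
  refine ⟨fun s => p + ∑' n, term n s, contDiff_const.add
    (contDiff_tsum_of_eventually (v := fun _ n => (1 / 2) ^ n) hterm
      (fun _ _ => summable_geometric_two) fun k _ => ?_), fun n s hs => ?_⟩
  · rw [Nat.cofinite_eq_atTop]
    filter_upwards [eventually_ge_atTop k] with n hn using hbound k n hn
  · have hs' := abs_le.1 hs
    have hzero : ∀ k ≠ n, term k (t n + s) = 0 := by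
      intro k hk
      have hb : β k (t n + s) = 0 := by
        apply (β k).zero_of_le_dist
        change t k / 4 ≤ _
        have h0 := ht0 k
        have h0' := ht0 n
        have step : ∀ i j, i < j → 2 * t j ≤ t i := by
          intro i j hij
          have : t j ≤ t (i + 1) := pow_le_pow_of_le_one (by norm_num) (by norm_num) hij
          have : t (i + 1) = t i * (1 / 2) := pow_succ _ _
          linarith
        rw [Real.dist_eq]
        rcases lt_or_gt_of_ne hk with h | h
        · have := step _ _ h
          exact (show t k / 4 ≤ -(t n + s - t k) by linarith).trans (neg_le_abs _)
        · have := step _ _ h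
          exact (show t k / 4 ≤ t n + s - t k by linarith).trans (le_abs_self _)
      simp [term, u, w, hb]
    have hone : β n (t n + s) = 1 := by
      apply (β n).one_of_mem_closedBall
      rw [Metric.mem_closedBall, Real.dist_eq, add_sub_cancel_left]
      exact hs
    change p + ∑' n, term n _ = _
    rw [tsum_eq_single n hzero]
    simp only [term, u, w, hone, one_smul, one_mul, add_sub_cancel_left, smul_smul]
    rw [← add_assoc, add_sub_cancel, mul_comm]

/-! ### Uniform bounds from bounds along smooth curves -/

section Curves

variable {E : Type*} [NormedAddCommGroup E] [NormedSpace ℝ E] [CompleteSpace E] {m : ℕ} {f : E → ℝ}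

/-- Otherwise a smooth curve would run through points converging to `p` at which `f` is unbounded. -/
lemma exists_bound_nhds_of_isZygmund_comp
    (hf : ∀ c : ℝ → E, ContDiff ℝ ∞ c → IsZygmund m (f ∘ c)) (p : E) :
    ∃ r > 0, ∃ C, ∀ a, ‖a - p‖ ≤ r → |f a| ≤ C := by
  obtain ⟨t, δ, ε, ht, hδ, hε, hcurve⟩ := exists_contDiff_curve_affine_pieces E
  by_contra! H
  choose a ha hfa using fun n : ℕ => H (ε n) (hε n) n
  obtain ⟨c, hc, hca⟩ := hcurve p 0 a (by simp) ha
  obtain ⟨B, hB⟩ := isCompact_Icc (a := (0 : ℝ)) (b := 1) |>.exists_bound_of_continuousOn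
    (hf c hc).1.continuous.continuousOn
  obtain ⟨n, hn⟩ := exists_nat_gt B
  have h1 := hca n 0 (by simpa using (hδ n).le)
  have h2 := hB (t n) (ht n)
  simp only [add_zero, smul_zero] at h1
  rw [Function.comp, h1, Real.norm_eq_abs] at h2
  linarith [hfa n]

lemma exists_abs_fwdDiff_le_nhds_of_isZygmund_comp
    (hf : ∀ c : ℝ → E, ContDiff ℝ ∞ c → IsZygmund m (f ∘ c)) {v : E} (hv : ‖v‖ ≤ 1) (p : E) :
    ∃ r > 0, ∃ C, ∀ a, ‖a - p‖ ≤ r → ∀ h, 0 < h → h ≤ r →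
      |(fwdDiff (h • v))^[m + 2] f a| ≤ C * h ^ (m + 1) := by
  obtain ⟨t, δ, ε, ht, hδ, hε, hcurve⟩ := exists_contDiff_curve_affine_pieces E
  by_contra! H
  have hm : (0 : ℝ) < m + 2 := by positivity
  -- Along the `n`-th piece the step `h n` is traversed in time `h n / ε n`, so a violation with
  -- constant `n / ε n ^ (m + 1)` becomes one with constant `n`.
  choose a ha h h0 hr hfa using fun n : ℕ =>
    H (min (ε n) (ε n * δ n / (m + 2))) (lt_min (hε n) (by have := hε n; have := hδ n; positivity))
      (n / ε n ^ (m + 1))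
  obtain ⟨c, hc, hca⟩ := hcurve p v a hv fun n => (ha n).trans (min_le_left _ _)
  obtain ⟨B, hB, hbd⟩ := (hf c hc).locallyDiffBounded 1
  obtain ⟨n, hn⟩ := exists_nat_gt B
  have hεn := hε n
  have hη0 : 0 < h n / ε n := div_pos (h0 n) hεn
  have hη1 : h n / ε n ≤ 1 := (div_le_one hεn).2 ((hr n).trans (min_le_left _ _))
  have h1 := (hbd (t n) ⟨by linarith [(ht n).1], (ht n).2⟩).2 _ hη0 hη1
  have h2 : (fwdDiff (h n / ε n))^[m + 2] (f ∘ c) (t n) =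
      (fwdDiff (h n • v))^[m + 2] f (a n) := by
    refine fwdDiff_iter_congr fun k hk => ?_
    have hk' : (k : ℝ) ≤ m + 2 := by exact_mod_cast hk
    have h3 : h n / ε n ≤ δ n / (m + 2) := by
      rw [div_le_iff₀ hεn]
      exact ((hr n).trans (min_le_right _ _)).trans_eq (by ring)
    have h4 : |k • (h n / ε n)| ≤ δ n := by
      rw [nsmul_eq_mul, abs_of_nonneg (by positivity)]
      calc (k : ℝ) * (h n / ε n) ≤ (m + 2) * (δ n / (m + 2)) := by gcongr
        _ = δ n := mul_div_cancel₀ _ hm.ne'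
    rw [Function.comp, hca n _ h4, nsmul_eq_mul, ← Nat.cast_smul_eq_nsmul ℝ k (h n • v), smul_smul]
    congr 3
    field_simp
  rw [h2, div_pow] at h1
  have h3 := hfa n
  have h4 : B * (h n ^ (m + 1) / ε n ^ (m + 1)) ≤ n / ε n ^ (m + 1) * h n ^ (m + 1) := by
    rw [div_mul_eq_mul_div, ← mul_div_assoc]
    have := h0 n
    gcongr
  linarith

lemma exists_bound_closedBall_of_isZygmund_comp [ProperSpace E]
    (hf : ∀ c : ℝ → E, ContDiff ℝ ∞ c → IsZygmund m (f ∘ c)) (R : ℝ) :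
    ∃ C, 0 ≤ C ∧ ∀ a ∈ Metric.closedBall (0 : E) R, |f a| ≤ C := by
  refine (isCompact_closedBall (0 : E) R).induction_on
    (p := fun s => ∃ C, 0 ≤ C ∧ ∀ a ∈ s, |f a| ≤ C) ⟨0, le_rfl, by simp⟩
    (fun s t hst ⟨C, hC, h⟩ => ⟨C, hC, fun a ha => h a (hst ha)⟩) ?_ fun p _ => ?_
  · rintro s t ⟨C, hC, h⟩ ⟨C', -, h'⟩
    refine ⟨max C C', le_max_of_le_left hC, ?_⟩
    rintro a (ha | ha)
    · exact (h a ha).trans (le_max_left _ _)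
    · exact (h' a ha).trans (le_max_right _ _)
  · obtain ⟨r, hr, C, h⟩ := exists_bound_nhds_of_isZygmund_comp hf p
    refine ⟨Metric.closedBall p r, mem_nhdsWithin_of_mem_nhds (Metric.closedBall_mem_nhds p hr),
      C, (abs_nonneg _).trans (h p (by simpa using hr.le)), fun a ha => h a ?_⟩
    rwa [← mem_closedBall_iff_norm]

/-- A function that is Zygmund of class `m` along all smooth curves has differences of order `m + 2`
in a fixed direction that are `O(h ^ (m + 1))`, uniformly on bounded sets. -/
lemma exists_abs_fwdDiff_le_closedBall_of_isZygmund_comp [ProperSpace E]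
    (hf : ∀ c : ℝ → E, ContDiff ℝ ∞ c → IsZygmund m (f ∘ c)) {v : E} (hv : ‖v‖ ≤ 1) (R : ℝ) :
    ∃ C, 0 ≤ C ∧ ∀ a ∈ Metric.closedBall (0 : E) R, ∀ h, 0 < h → h ≤ 1 →
      |(fwdDiff (h • v))^[m + 2] f a| ≤ C * h ^ (m + 1) := by
  have small : ∃ r > 0, ∃ C, 0 ≤ C ∧ ∀ a ∈ Metric.closedBall (0 : E) R, ∀ h, 0 < h → h ≤ r →
      |(fwdDiff (h • v))^[m + 2] f a| ≤ C * h ^ (m + 1) := by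
    refine (isCompact_closedBall (0 : E) R).induction_on
      (p := fun s => ∃ r > 0, ∃ C, 0 ≤ C ∧ ∀ a ∈ s, ∀ h, 0 < h → h ≤ r →
        |(fwdDiff (h • v))^[m + 2] f a| ≤ C * h ^ (m + 1)) ⟨1, one_pos, 0, le_rfl, by simp⟩
      (fun s t hst ⟨r, hr, C, hC, h⟩ => ⟨r, hr, C, hC, fun a ha => h a (hst ha)⟩) ?_ fun p _ => ?_
    · rintro s t ⟨r, hr, C, hC, h⟩ ⟨r', hr', C', -, h'⟩
      refine ⟨min r r', lt_min hr hr', max C C', le_max_of_le_left hC, ?_⟩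
      rintro a (ha | ha) τ h0 h1
      · refine (h a ha τ h0 (h1.trans (min_le_left _ _))).trans ?_
        gcongr
        exact le_max_left _ _
      · refine (h' a ha τ h0 (h1.trans (min_le_right _ _))).trans ?_
        gcongr
        exact le_max_right _ _
    · obtain ⟨r, hr, C, h⟩ := exists_abs_fwdDiff_le_nhds_of_isZygmund_comp hf hv p
      refine ⟨Metric.closedBall p r, mem_nhdsWithin_of_mem_nhds (Metric.closedBall_mem_nhds p hr),
        r, hr, max C 0, le_max_right _ _, fun a ha τ h0 h1 => ?_⟩
      rw [mem_closedBall_iff_norm] at ha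
      refine (h a ha τ h0 h1).trans ?_
      gcongr
      exact le_max_left _ _
  obtain ⟨r, hr, C, hC, h⟩ := small
  obtain ⟨B, hB, hbd⟩ := exists_bound_closedBall_of_isZygmund_comp hf (R + (m + 2))
  refine ⟨max C (2 ^ (m + 2) * B / r ^ (m + 1)), le_max_of_le_left hC, fun a ha τ h0 h1 => ?_⟩
  rcases le_total τ r with hτ | hτ
  · refine (h a ha τ h0 hτ).trans ?_
    gcongr
    exact le_max_left _ _
  · have e1 : |(fwdDiff (τ • v))^[m + 2] f a| ≤ 2 ^ (m + 2) * B :=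
      abs_fwdDiff_iter_le fun k hk => hbd _ (by
        have hk' : (k : ℝ) ≤ m + 2 := by exact_mod_cast hk
        rw [mem_closedBall_zero_iff] at ha ⊢
        refine norm_add_le_of_le ha ?_
        rw [← Nat.cast_smul_eq_nsmul ℝ, norm_smul, norm_smul, Real.norm_of_nonneg (by positivity),
          Real.norm_of_nonneg h0.le]
        calc (k : ℝ) * (τ * ‖v‖) ≤ (m + 2) * (1 * 1) := by gcongr
          _ = m + 2 := by ring)
    calc _ ≤ 2 ^ (m + 2) * B := e1
      _ = 2 ^ (m + 2) * B / r ^ (m + 1) * r ^ (m + 1) := by field_simp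
      _ ≤ _ := by
        gcongr
        exact le_max_right _ _

end Curves

/-! ### The partial derivative -/

theorem mainTheorem7 (m : ℕ) (hm : 1 ≤ m) (f : ℝ × ℝ → ℝ)
    (hf : ∀ c : ℝ → ℝ × ℝ, ContDiff ℝ ∞ c → IsZygmund m (f ∘ c)) :
    (∀ x : ℝ, DifferentiableAt ℝ (fun y : ℝ => f (x, y)) 0) ∧
      IsZygmund (m - 1) (fun x : ℝ => deriv (fun y : ℝ => f (x, y)) 0) := by
  obtain ⟨q, rfl⟩ : ∃ q, m = q + 1 := ⟨m - 1, by omega⟩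
  have hd : ∀ x : ℝ, DifferentiableAt ℝ (fun y : ℝ => f (x, y)) 0 := fun x =>
    (isZygmund_succ_iff.1 (hf (fun y => (x, y)) (contDiff_const.prodMk contDiff_id))).1 0
  refine ⟨hd, LocallyDiffBounded.isZygmund (n := q + 1) fun R => ?_⟩
  set N : ℕ := q + 1 + 2 with hN
  obtain ⟨K, hK, hint⟩ := exists_abs_deriv_le (q + 1)
  -- Large enough for all the points at which `f` is evaluated below.
  set L : ℝ := |R| + N + N ^ 2 with hL
  obtain ⟨B, hB, hbd⟩ := exists_bound_closedBall_of_isZygmund_comp hf L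
  obtain ⟨C₁, hC₁, h₁⟩ := exists_abs_fwdDiff_le_closedBall_of_isZygmund_comp hf
    (v := ((1 : ℝ), (0 : ℝ))) (by simp) L
  obtain ⟨C₂, hC₂, h₂⟩ := exists_abs_fwdDiff_le_closedBall_of_isZygmund_comp hf
    (v := ((0 : ℝ), (1 : ℝ))) (by simp) L
  simp only [Prod.smul_mk, smul_eq_mul, mul_one, mul_zero] at h₁ h₂
  have hmem : ∀ x ∈ Set.Icc (-R) R, ∀ y ∈ Set.Icc (0 : ℝ) (0 + (((q + 1 : ℕ) : ℝ) + 2) ^ 2),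
      ∀ k ≤ N, ∀ h : ℝ, 0 < h → h ≤ 1 →
        ((x, y) : ℝ × ℝ) + k • ((h, 0) : ℝ × ℝ) ∈ Metric.closedBall (0 : ℝ × ℝ) L := by
    intro x hx y hy k hk h h0 h1
    have hk' : (k : ℝ) ≤ N := by exact_mod_cast hk
    have e1 : (k : ℝ) * h ≤ N * 1 := by gcongr
    have e2 : 0 ≤ (k : ℝ) * h := by positivity
    have e3 : (0 : ℝ) ≤ (N : ℝ) ^ 2 := by positivity
    have e4 : (((q + 1 : ℕ) : ℝ) + 2) = N := by rw [hN]; push_cast; ring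
    have e5 := le_abs_self R
    have e6 : (0 : ℝ) ≤ N := by positivity
    rw [e4, zero_add] at hy
    rw [mem_closedBall_zero_iff, Prod.norm_def]
    refine max_le ?_ ?_
    · simp only [Prod.smul_mk, Prod.mk_add_mk, nsmul_eq_mul, Real.norm_eq_abs]
      rw [abs_le]
      constructor <;> linarith [hx.1, hx.2]
    · simp only [Prod.smul_mk, Prod.mk_add_mk, smul_zero, add_zero, Real.norm_eq_abs]
      rw [abs_le]
      constructor <;> linarith [hy.1, hy.2, abs_nonneg R]
  have hmem' : ∀ x ∈ Set.Icc (-R) R, ∀ y ∈ Set.Icc (0 : ℝ) (0 + (((q + 1 : ℕ) : ℝ) + 2) ^ 2),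
      ((x, y) : ℝ × ℝ) ∈ Metric.closedBall (0 : ℝ × ℝ) L := fun x hx y hy => by
    simpa using hmem x hx y hy 0 (by omega) 1 one_pos le_rfl
  have hvert : ∀ (G : ℝ × ℝ → ℝ) (x y t : ℝ),
      (fwdDiff t)^[N] (fun y => G (x, y)) y = (fwdDiff ((0 : ℝ), t))^[N] G (x, y) :=
    fun G x y t => fwdDiff_iter_congr fun k _ => by simp
  have hhor : ∀ x y h : ℝ,
      (fwdDiff h)^[N] (fun x => f (x, y)) x = (fwdDiff (h, (0 : ℝ)))^[N] f (x, y) :=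
    fun x y h => fwdDiff_iter_congr fun k _ => by simp
  set A : ℝ := B + C₁ + 2 ^ N * C₂ with hA
  have h2 : (1 : ℝ) ≤ 2 ^ N := one_le_pow₀ one_le_two
  have hC₂' : C₂ ≤ 2 ^ N * C₂ := le_mul_of_one_le_left hC₂ h2
  have hA0 : 0 ≤ A := by positivity
  refine ⟨K * A, by positivity, fun x hx => ⟨?_, fun h h0 h1 => ?_⟩⟩
  · have := hint (fun y => f (x, y)) A 1 0 _ q hA0 one_pos le_rfl
      (fun y hy => by
        refine (hbd _ (hmem' x hx y hy)).trans ?_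
        rw [one_pow, mul_one]
        linarith)
      (fun y hy t ht ht1 => by
        change |(fwdDiff t)^[N] (fun y => f (x, y)) y| ≤ _
        rw [hvert f]
        refine (h₂ _ (hmem' x hx y hy) t ht ht1).trans ?_
        gcongr
        linarith)
      (hd x).hasDerivAt
    simpa using this
  · -- The `N`-th difference in `x` of the partial derivative is the derivative at `0` of
    -- `y ↦ (fwdDiff (h, 0))^[N] f (x, y)`.
    refine hint (fun y => (fwdDiff (h, (0 : ℝ)))^[N] f (x, y)) A h 0 _ q hA0 h0 h1
      (fun y hy => ?_) (fun y hy t ht hth => ?_) ?_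
    · refine (h₁ _ (hmem' x hx y hy) h h0 h1).trans ?_
      gcongr
      linarith
    · change |(fwdDiff t)^[N] (fun y => (fwdDiff (h, (0 : ℝ)))^[N] f (x, y)) y| ≤ _
      rw [hvert, fwdDiff_iter_comm]
      refine (abs_fwdDiff_iter_le fun k hk =>
        h₂ _ (hmem x hx y hy k hk h h0 h1) t ht (hth.trans h1)).trans ?_
      rw [← mul_assoc]
      gcongr
      linarith
    · simp only [← hhor]
      exact hasDerivAt_fwdDiff_iter (F := fun y x => f (x, y)) (fun x => (hd x).hasDerivAt) h N x
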